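/- Let $n>1$, $\tau,\hbar\in\mathbb{C}$ with $\operatorname{Im}\tau>0$ and $\hbar\notin\mathbb{Z}+\mathbb{Z}\tau$. Put $$\theta_{m,l}(u,\tau)=\sum_{\mu\in m+l\mathbb{Z}}\exp 2\pi i\Bigl(\mu u+\tfrac{\mu^2}{2l}\tau\Bigr),\qquad \theta(u)=\theta_{\frac12,1}(u+\tfrac12,\tau),\qquad \theta_j(u)=\theta_{\frac n2-j,n}(u+\tfrac12,\tau),$$ and let $\eta$ be the Dedekind eta function. Let $\mathbf{h}^*\subset\mathbb{C}^n$ be the orthogonal complement of $\epsilon_1+\cdots+\epsilon_n$ for the standard bilinear form $\langle\cdot,\cdot\rangle$, let $\bar\epsilon_k$ be the orthogonal projection of $\epsilon_k$ to $\mathbf{h}^*$, and put $(T_kf)(\lambda)=f(\lambda+\hbar\bar\epsilon_k)$ for functions $f$ on $\mathbf{h}^*$. For $\lambda\in\mathbf{h}^*$ set $$\phi(u)_{\lambda,j}^{k}=\frac{\theta_j(\frac un-\langle\lambda,\bar\epsilon_k\rangle)}{\sqrt{-1}\,\eta(\tau)}\qquad(j,k=1,\dots,n),$$ and let $[\bar\phi(u)_\lambda^{k,j}]_{k,j}$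 be the inverse of the matrix $[\phi(u)_{\lambda,j}^{k}]_{j,k}$. For $c,u\in\mathbb{C}$ define the matrices of difference operators $L(c|u)=[L(c|u)^i_j]$ and $\tilde L(c|u)=[\tilde L(c|u)^{i}_{j}]$, $1\le i,j\le n$, by $$L(c|u)^i_j=\sum_{k=1}^n\phi(u+c\hbar)_{\lambda,j}^{k}\,\bar\phi(u)_\lambda^{k,i}\,T_k,\qquad \tilde L(c|u)^{i}_{j}=\sum_{a,b=1}^n\bar\phi(u)_\lambda^{j,b}\,\phi(u)_{\lambda,a}^{i}\,L(c|u)^a_b .$$ For $0\le d\le n$ let $M_d(c|u)$ be the trace of the $d$-th antisymmetrically fused L-operator, $$M_d(c|u)=\sum_{1\le i_1<\cdots<i_d\le n}\ \sum_{\sigma\in S(d)}\operatorname{sgn}(\sigma)\,L(c|u)^{i_{\sigma(1)}}_{i_1}\,L(c|u-\hbar)^{i_{\sigma(2)}}_{i_2}\cdots L(c|u-(d-1)\hbar)^{i_{\sigma(d)}}_{i_d},$$ a composition of operators in the order written, so that $M_0(c|u)=\mathrm{id}$. Let ${:}\ {:}$ denote the normal product of difference operators, in which all shift operators are put to the right of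 all functions, ${:}f(\lambda)T\,g(\lambda)T'{:}=f(\lambda)g(\lambda)TT'$; under it difference operators multiply commutatively, and ${:}\det A{:}$ is the determinant of a matrix $A$ of difference operators formed with this product. Assume $\theta(u-k\hbar)\neq0$ for $0\le k\le n-1$. Then for every $t\in\mathbb{C}$ $$\sum_{d=0}^n(-t)^{n-d}M_d(c|u)={:}\det[L(c|u)-t]{:}={:}\det[\tilde L(c|u)-t]{:}$$ as difference operators. More precisely, the three operators, applied to an arbitrary function $f:\mathbf{h}^*\to\mathbb{C}$, have the same value at every $\lambda\in\mathbf{h}^*$ such that $\theta(\langle\lambda,\bar\epsilon_i-\bar\epsilon_j\rangle+m\hbar)\neq0$ for all $i\neq j$ and all integers $m$ with $|m|<n$. -/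

import Mathlib

open Complex

noncomputable section

namespace EllipticRuijsenaars

/-! ### Theta functions -/

/-- `θ_{m,l}(u, τ) = ∑_{μ ∈ m + lℤ} exp 2πi (μ u + μ² τ / (2l))`. -/
def thetaChar (m : ℂ) (l : ℕ) (u τ : ℂ) : ℂ :=
  ∑' k : ℤ, Complex.exp (2 * Real.pi * I *
    ((m + l * k) * u + (m + l * k) ^ 2 / (2 * l) * τ))

/-- The Jacobi theta function `θ(u) = θ_{1/2,1}(u + 1/2, τ)`. -/
def theta (τ u : ℂ) : ℂ := thetaChar (1 / 2) 1 (u + 1 / 2) τ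

/-- `θ_j(u) = θ_{n/2-j,n}(u + 1/2, τ)`. -/
def thetaIdx (n : ℕ) (τ : ℂ) (j : ℕ) (u : ℂ) : ℂ :=
  thetaChar ((n : ℂ) / 2 - j) n (u + 1 / 2) τ

/-! ### The weight space of type `A_{n-1}` -/

/-- The orthogonal complement of `ε_1 + ⋯ + ε_n` in `ℂⁿ`. -/
def weightSpace (n : ℕ) : Submodule ℂ (Fin n → ℂ) where
  carrier := {v | ∑ i, v i = 0}
  add_mem' := by
    intro a b ha hb
    simp only [Set.mem_ofPred_eq, Pi.add_apply, Finset.sum_add_distrib] at *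
    rw [ha, hb, add_zero]
  zero_mem' := by simp
  smul_mem' := by
    intro c a ha
    simp only [Set.mem_ofPred_eq, Pi.smul_apply, smul_eq_mul] at *
    rw [← Finset.mul_sum, ha, mul_zero]

/-- The orthogonal projection `ε̄_k = ε_k - (ε_1 + ⋯ + ε_n) / n` of the `k`-th basis vector. -/
def epsBar (n : ℕ) (k : Fin n) : weightSpace n :=
  ⟨fun i => (if i = k then 1 else 0) - 1 / (n : ℂ), by
    have hn : (n : ℂ) ≠ 0 := Nat.cast_ne_zero.mpr (Fin.pos k).ne'
    change ∑ i, ((if i = k then (1 : ℂ) else 0) - 1 / (n : ℂ)) = 0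
    simp [Finset.sum_sub_distrib, hn]⟩

/-- The standard bilinear form on `ℂⁿ`, restricted to the weight space. -/
def pairing {n : ℕ} (v w : weightSpace n) : ℂ := ∑ i, v.1 i * w.1 i

/-- Functions on the weight space. -/
abbrev Fn (n : ℕ) : Type := weightSpace n → ℂ

/-- Linear operators on functions on the weight space. -/
abbrev Op (n : ℕ) : Type := Module.End ℂ (Fn n)

/-- The operator of multiplication by `a`. -/
def mulOp {n : ℕ} (a : Fn n) : Op n where
  toFun f := fun v => a v * f v
  map_add' f g := by ext v; simp [mul_add]
  map_smul' r f := by ext v; simp; ring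

/-- The shift operator `(T f)(v) = f(v + w)`. -/
def shiftOp {n : ℕ} (w : weightSpace n) : Op n where
  toFun f := fun v => f (v + w)
  map_add' _ _ := rfl
  map_smul' _ _ := rfl

/-! ### Difference operators and the normal product -/

/-- Normally ordered expressions `∑_w a_w(λ) T^w` (a finite sum over shifts `w`), with the
commutative product `(a T^w)(b T^{w'}) = a b T^{w + w'}`. -/
abbrev DiffSymbol (n : ℕ) : Type := AddMonoidAlgebra (Fn n) (weightSpace n)

/-- The difference operator of a normally ordered expression: the coefficient functions act by
multiplication, to the left of the shifts. -/
def quantize {n : ℕ} (s : DiffSymbol n) : Op n :=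
  s.coeff.sum fun w a => mulOp a * shiftOp w

theorem quantize_apply {n : ℕ} (s : DiffSymbol n) (f : Fn n) (v : weightSpace n) :
    quantize s f v = s.coeff.sum fun w a => a v * f (v + w) := by
  simp [quantize, Finsupp.sum, LinearMap.sum_apply, Finset.sum_apply, mulOp, shiftOp]

theorem quantize_single {n : ℕ} (w : weightSpace n) (a : Fn n) :
    quantize (AddMonoidAlgebra.single w a) = mulOp a * shiftOp w := by
  ext f v
  rw [quantize_apply, AddMonoidAlgebra.coeff_single, Finsupp.sum_single_index (by simp)]
  rfl

theorem quantize_add {n : ℕ} (s s' : DiffSymbol n) :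
    quantize (s + s') = quantize s + quantize s' := by
  ext f v
  simp only [LinearMap.add_apply, Pi.add_apply, quantize_apply, AddMonoidAlgebra.coeff_add]
  exact Finsupp.sum_add_index' (by simp) (by intro w a b; simp [add_mul])

/-- A difference operator has only one normally ordered expression. -/
theorem quantize_injective {n : ℕ} : Function.Injective (quantize (n := n)) := by
  classical
  intro s s' h
  have key : ∀ (r : DiffSymbol n) (v w : weightSpace n),
      quantize r (fun x => if x = v + w then 1 else 0) v = r.coeff w v := by
    intro r v w
    rw [quantize_apply, Finsupp.sum]
    simp only [add_right_inj, mul_ite, mul_one, mul_zero, Finset.sum_ite_eq']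
    split_ifs with hw
    · rfl
    · rw [Finsupp.notMem_support_iff.mp hw]; rfl
  apply AddMonoidAlgebra.coeff_injective
  ext w v
  rw [← key s v w, ← key s' v w, h]

/-- The normally ordered expression of a difference operator (a junk value on operators that are
not finite sums of functions times shifts). -/
def symbol {n : ℕ} : Op n → DiffSymbol n := Function.invFun quantize

theorem symbol_quantize {n : ℕ} (s : DiffSymbol n) : symbol (quantize s) = s :=
  Function.leftInverse_invFun quantize_injective s

/-- The normally ordered determinant `:det A:` of a matrix of difference operators: the
determinant is expanded with respect to the normal product, in which all shifts are put to the
right of all functions. -/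
def normalDet {n : ℕ} (A : Matrix (Fin n) (Fin n) (Op n)) : Op n :=
  quantize (A.map symbol).det

/-! ### Intertwining vectors and the factorized L-operator -/

/-- The matrix `[φ(u)^{μ+ħε̄_k}_μ _j]_{j,k}` of outgoing intertwining vectors, with entries
`θ_j(u/n - ⟨μ, ε̄_k⟩) / (√-1 η(τ))`; the index `j : Fin n` stands for `j + 1 ∈ {1, …, n}`. -/
def outVec (n : ℕ) (τ u : ℂ) (μ : weightSpace n) : Matrix (Fin n) (Fin n) ℂ :=
  Matrix.of fun j k =>
    thetaIdx n τ (j + 1) (u / n - pairing μ (epsBar n k)) / (I * ModularForm.eta τ)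

/-- The incoming intertwining vectors `[φ̄(u)^{μ+ħε̄_k}_μ ^j]_{k,j}`: the inverse matrix. -/
def inVec (n : ℕ) (τ u : ℂ) (μ : weightSpace n) : Matrix (Fin n) (Fin n) ℂ :=
  (outVec n τ u μ)⁻¹

/-- The factorized L-operator `L(c|u)`; the entry `i j` is `L(c|u)^i_j`, that is
`(L(c|u)^i_j f)(μ) = ∑_k φ(u+cħ)^{μ+ħε̄_k}_{μ,j} φ̄(u)^{μ+ħε̄_k,i}_μ f(μ+ħε̄_k)`. -/
def lOp (n : ℕ) (τ ℏ c u : ℂ) : Matrix (Fin n) (Fin n) (Op n) :=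
  Matrix.of fun i j => ∑ k : Fin n,
    mulOp (fun μ => outVec n τ (u + c * ℏ) μ j k * inVec n τ u μ k i) * shiftOp (ℏ • epsBar n k)

/-- The conjugated Lax matrix `L̃(c|u)`; the entry `i' j'` is `L̃(c|u)^{i'}_{j'}`, that is
`∑_{i,j} φ̄(u)^{λ+ħε̄_{j'},j}_λ φ(u)^{λ+ħε̄_{i'}}_{λ,i} L(c|u)^i_j`. -/
def lTildeOp (n : ℕ) (τ ℏ c u : ℂ) : Matrix (Fin n) (Fin n) (Op n) :=
  Matrix.of fun i' j' => ∑ i : Fin n, ∑ j : Fin n,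
    mulOp (fun v => inVec n τ u v j' j * outVec n τ u v i i') * lOp n τ ℏ c u i j

/-! ### Fusion and the transfer matrices -/

/-- The fused L-operator `L(c|1^d_u)` in the degree `d` exterior representation. The increasing
sequences `i_1 < ⋯ < i_d` in `{1, …, n}` index the basis, and the entry `(I, I')` is
`∑_σ sgn(σ) L(c|u)^{i_σ(1)}_{i'_1} L(c|u-ħ)^{i_σ(2)}_{i'_2} ⋯ L(c|u-(d-1)ħ)^{i_σ(d)}_{i'_d}`,
the product being composition of operators in this order. -/
def fusedL (n : ℕ) (τ ℏ c u : ℂ) (d : ℕ) :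
    Matrix (Fin d ↪o Fin n) (Fin d ↪o Fin n) (Op n) :=
  Matrix.of fun i i' => ∑ σ : Equiv.Perm (Fin d),
    (Equiv.Perm.sign σ : ℤ) •
      (List.ofFn fun a : Fin d => lOp n τ ℏ c (u - (a : ℕ) * ℏ) (i (σ a)) (i' a)).prod

/-- `M_d(c|u)`, the trace of the fused L-operator. -/
def transferM (n : ℕ) (τ ℏ c u : ℂ) (d : ℕ) : Op n :=
  (fusedL n τ ℏ c u d).trace

/-- `M_0(c|u)` is the identity. -/
theorem transferM_zero (n : ℕ) (τ ℏ c u : ℂ) : transferM n τ ℏ c u 0 = 1 := by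
  have : Unique (Fin 0 ↪o Fin n) :=
    { default := OrderEmbedding.ofStrictMono Fin.elim0 (fun a => a.elim0)
      uniq := fun g => by ext a; exact a.elim0 }
  simp [transferM, fusedL, Matrix.trace]

/-- The points of the weight space at which none of the coefficients of the operators `L(c|·)`
that enter `M_0, …, M_n` has a pole in `λ`: `θ(⟨λ, ε̄_i - ε̄_j⟩ + mħ) ≠ 0` for `i ≠ j` and
integers `|m| < n`. -/
def regularSet (n : ℕ) (τ ℏ : ℂ) : Set (weightSpace n) :=
  {v | ∀ i j : Fin n, i ≠ j → ∀ m : ℤ, |m| < n →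
    theta τ (pairing v (epsBar n i - epsBar n j) + m * ℏ) ≠ 0}

end EllipticRuijsenaars

end

namespace EllipticRuijsenaars

/-! Both sides are expanded over sequences `k : Fin d → Fin n` of shift directions. For each `k`, a
principal minor of the symbol of `L` contributes a product of outgoing vectors times a minor of
incoming vectors, all at `(u, λ)` (`symbolEval_det_submatrix_lMat`). `M_d` contributes the same
expression, with factor `a` taken at `u - aħ` and at `λ` moved by the earlier shifts
(`transferM_apply`).

In the argument `u/n - ⟨λ, ε̄_j⟩` these two displacements cancel unless direction `j` was already
used (`outVec_shifted_of_forall_ne`). For injective `k` the outgoing factors therefore agree, and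
the incoming rows change by a unitriangular matrix; for repeated directions both minors vanish
(`det_rows_inv_eq`). Summing principal minors gives the characteristic determinant, and `L̃` is a
conjugate of `L` under the commutative normal product.

The intertwining matrix is shown invertible without evaluating its determinant: suitable products of
Jacobi theta functions lie in the span of the `θ_j` and separate the points (`isUnit_det_thetaIdx`).
-/

/-! ### Spaces of theta functions, by Fourier series -/

/-- `F` is an everywhere absolutely convergent series `∑ a_k exp (2πi k x)` whose coefficients
satisfy `a_{k+m} = α q^k a_k`, where `q = exp (2πi τ)`. -/
def IsThetaSeries (τ : ℂ) (m : ℤ) (α : ℂ) (F : ℂ → ℂ) : Prop :=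
  ∃ a : ℤ → ℂ, (∀ x, HasSum (fun k : ℤ => a k * cexp (2 * Real.pi * I * (k * x))) (F x)) ∧
    ∀ k, a (k + m) = α * cexp (2 * Real.pi * I * (k * τ)) * a k

theorem IsThetaSeries.one (τ : ℂ) : IsThetaSeries τ 0 1 1 := by
  refine ⟨fun k => if k = 0 then 1 else 0, fun x => ?_, fun k => ?_⟩
  · convert hasSum_single (0 : ℤ) ?_ using 1
    · simp
    · intro k hk; simp [hk]
  · by_cases hk : k = 0 <;> simp [hk]

theorem IsThetaSeries.mul {τ : ℂ} {m m' : ℤ} {α α' : ℂ} {F G : ℂ → ℂ}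
    (hF : IsThetaSeries τ m α F) (hG : IsThetaSeries τ m' α' G) :
    IsThetaSeries τ (m + m') (α * α') (F * G) := by
  obtain ⟨a, ha, ha'⟩ := hF
  obtain ⟨b, hb, hb'⟩ := hG
  let e : ℤ × ℤ ≃ ℤ × ℤ :=
    { toFun := fun p => (p.1 - p.2, p.2)
      invFun := fun p => (p.1 + p.2, p.2)
      left_inv := fun p => by simp
      right_inv := fun p => by simp }
  have key : ∀ x, HasSum (fun p : ℤ × ℤ =>
      a (p.1 - p.2) * b p.2 * cexp (2 * Real.pi * I * (p.1 * x))) (F x * G x) := by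
    intro x
    have hs : Summable fun p : ℤ × ℤ => (a p.1 * cexp (2 * Real.pi * I * (p.1 * x))) *
        (b p.2 * cexp (2 * Real.pi * I * (p.2 * x))) :=
      summable_mul_of_summable_norm (f := fun k : ℤ => a k * cexp (2 * Real.pi * I * (k * x)))
        (g := fun k : ℤ => b k * cexp (2 * Real.pi * I * (k * x)))
        (ha x).summable.norm (hb x).summable.norm
    have h := (ha x).mul (hb x) hs
    refine ((Equiv.hasSum_iff e).mpr h).congr_fun fun p => ?_
    have hexp : cexp (2 * Real.pi * I * (p.1 * x)) =
        cexp (2 * Real.pi * I * ((p.1 - p.2 : ℤ) * x)) * cexp (2 * Real.pi * I * (p.2 * x)) := by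
      rw [← Complex.exp_add]; congr 1; push_cast; ring
    simp only [Function.comp_apply, e, Equiv.coe_fn_mk, hexp]
    ring
  refine ⟨fun N => ∑' l, a (N - l) * b l, fun x => ?_, fun N => ?_⟩
  · refine (key x).prod_fiberwise fun N => ?_
    have h := ((key x).summable.prod_factor N).hasSum
    simp only [tsum_mul_right] at h
    exact h
  · beta_reduce
    -- Shifting `l` by `m'` lets both recursions apply termwise; their factors `q^(N-l)` and `q^l`
    -- combine to `q^N`.
    rw [← (Equiv.addRight m').tsum_eq, ← tsum_mul_left]
    refine tsum_congr fun l => ?_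
    have hexp : cexp (2 * Real.pi * I * (N * τ)) =
        cexp (2 * Real.pi * I * ((N - l : ℤ) * τ)) * cexp (2 * Real.pi * I * (l * τ)) := by
      rw [← Complex.exp_add]; congr 1; push_cast; ring
    rw [Equiv.coe_addRight, hb', show N + (m + m') - (l + m') = (N - l) + m by ring, ha', hexp]
    ring

theorem IsThetaSeries.prod {ι : Type*} (s : Finset ι) {τ : ℂ} {m : ι → ℤ} {α : ι → ℂ}
    {F : ι → ℂ → ℂ} (h : ∀ i ∈ s, IsThetaSeries τ (m i) (α i) (F i)) :
    IsThetaSeries τ (∑ i ∈ s, m i) (∏ i ∈ s, α i) (∏ i ∈ s, F i) := by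
  classical
  induction s using Finset.induction_on with
  | empty => simpa using IsThetaSeries.one τ
  | insert i s hi ih =>
    rw [Finset.sum_insert hi, Finset.prod_insert hi, Finset.prod_insert hi]
    exact (h i (Finset.mem_insert_self i s)).mul
      (ih fun j hj => h j (Finset.mem_insert_of_mem hj))

/-- The reflection `k ↦ -1 - k` sends the half-integer `μ = k + 1/2` to `-μ`, and `exp(πiμ)` is odd
in such `μ`. -/
theorem theta_zero (τ : ℂ) : theta τ 0 = 0 := by
  have h : theta τ 0 = -theta τ 0 := by
    conv_lhs => rw [theta, thetaChar, ← (Equiv.subLeft (-1 : ℤ)).tsum_eq]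
    rw [theta, thetaChar, ← tsum_neg]
    refine tsum_congr fun k => ?_
    rw [← Complex.exp_add_pi_mul_I, ← Complex.exp_periodic.int_mul (-k - 1) (_ + Real.pi * I)]
    congr 1
    rw [Equiv.subLeft_apply]
    push_cast; ring
  exact self_eq_neg.mp h

/-- The Jacobi theta function with zero at `b` is a theta series of degree one, up to an
exponential factor. -/
theorem isThetaSeries_theta {τ : ℂ} (hτ : 0 < τ.im) (b : ℂ) :
    IsThetaSeries τ 1 (cexp (2 * Real.pi * I * (1 / 2 + τ - b)))
      (fun x => cexp (-(Real.pi * I * x)) * theta τ (x - b)) := by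
  refine ⟨fun k => cexp (2 * Real.pi * I *
    ((k + 1 / 2) * (1 / 2 - b) + (k + 1 / 2) ^ 2 / 2 * τ)), fun x => ?_, fun k => ?_⟩
  · have hs := (summable_jacobiTheta₂_term_iff (x - b + 1 / 2 + τ / 2) τ).mpr hτ
    have hs' := hs.mul_left (cexp (Real.pi * I * (x - b + 1 / 2 + τ / 4)))
    have h : Summable fun k : ℤ => cexp (2 * Real.pi * I *
        ((1 / 2 + (1 : ℕ) * k) * (x - b + 1 / 2) +
          (1 / 2 + (1 : ℕ) * k) ^ 2 / (2 * (1 : ℕ)) * τ)) := by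
      refine hs'.congr fun k => ?_
      rw [jacobiTheta₂_term, ← Complex.exp_add]
      congr 1; push_cast; ring
    refine (h.hasSum.mul_left (cexp (-(Real.pi * I * x)))).congr_fun fun k => ?_
    rw [← Complex.exp_add, ← Complex.exp_add]
    congr 1; push_cast; ring
  · beta_reduce
    rw [← Complex.exp_add, ← Complex.exp_add]
    congr 1; push_cast; ring

/-- A theta series of degree `n` with the multiplier of the `θ_j` is a linear combination of
them. -/
theorem IsThetaSeries.exists_eq_sum_thetaIdx {n : ℕ} (hn : n ≠ 0) {τ : ℂ} {F : ℂ → ℂ}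
    (hF : IsThetaSeries τ n (cexp (2 * Real.pi * I * (n / 2 + n * τ))) F) :
    ∃ c : Fin n → ℂ, ∀ x,
      cexp (Real.pi * I * (n * x)) * F x = ∑ j : Fin n, c j * thetaIdx n τ (j + 1) x := by
  have : NeZero n := ⟨hn⟩
  have hn' : (n : ℂ) ≠ 0 := Nat.cast_ne_zero.mpr hn
  obtain ⟨a, ha, ha'⟩ := hF
  -- `exp (g N)` is the coefficient of `exp 2πi(N + n/2)x` in the `θ_j` containing that frequency.
  -- It obeys the same recursion as `a N`, so their ratio is `n`-periodic.
  set g : ℤ → ℂ := fun N => 2 * Real.pi * I *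
    ((N + n / 2) / 2 + (N + n / 2) ^ 2 / (2 * n) * τ) with hg
  have hper : Function.Periodic (fun N => a N * cexp (-g N)) (n : ℤ) := by
    intro N
    simp only [ha']
    have : cexp (-g N) = cexp (2 * Real.pi * I * (n / 2 + n * τ)) *
        cexp (2 * Real.pi * I * (N * τ)) * cexp (-g (N + n)) := by
      rw [← Complex.exp_add, ← Complex.exp_add]
      congr 1; simp only [hg]; push_cast; field_simp; ring
    rw [this]; ring
  have hcoef : ∀ (k : ℤ) (j : Fin n), a (-(j + 1 : ℤ) + k * n) =
      (a (-(j + 1 : ℤ)) * cexp (-g (-(j + 1 : ℤ)))) * cexp (g (-(j + 1 : ℤ) + k * n)) := by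
    intro k j
    have := (hper.int_mul k) (-(j + 1 : ℤ))
    simp only [Int.cast_id] at this
    rw [← this, mul_assoc, ← Complex.exp_add, neg_add_cancel, Complex.exp_zero, mul_one]
  -- Sorts the frequencies into the residue classes of `-(j + 1)` mod `n`, one for each `θ_{j+1}`.
  let e : Fin n × ℤ ≃ ℤ := (Equiv.prodComm _ _).trans
    (((Equiv.neg ℤ).prodCongr (Equiv.refl _)).trans
      ((Int.divModEquiv n).symm.trans ((Equiv.neg ℤ).trans (Equiv.subRight 1))))
  have he : ∀ p : Fin n × ℤ, e p = -(p.1 + 1 : ℤ) + p.2 * n := by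
    intro p
    simp only [e, Equiv.trans_apply, Equiv.prodComm_apply, Equiv.prodCongr_apply,
      Int.divModEquiv_symm_apply, Equiv.neg_apply, Equiv.subRight_apply, Prod.map_apply',
      Prod.fst_swap, Prod.snd_swap, Equiv.refl_apply]
    ring
  refine ⟨fun j => a (-(j + 1 : ℤ)) * cexp (-g (-(j + 1 : ℤ))), fun x => ?_⟩
  have h := ((Equiv.hasSum_iff e).mpr (ha x)).mul_left (cexp (Real.pi * I * (n * x)))
  refine ((h.prod_fiberwise fun j => (h.summable.prod_factor j).hasSum).unique
    (hasSum_fintype _)).trans (Finset.sum_congr rfl fun j _ => ?_)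
  rw [thetaIdx, thetaChar, ← tsum_mul_left]
  refine tsum_congr fun k => ?_
  simp only [Function.comp_apply, he, hcoef]
  rw [mul_assoc _ (cexp (g _)), ← Complex.exp_add, mul_left_comm, ← Complex.exp_add]
  congr 2
  simp only [hg]; push_cast; field_simp; ring

/-- The vectors `(θ_j(x_k))_j` are linearly independent as soon as the `x_k` are distinct and do
not sum up to zero on the elliptic curve. -/
theorem isUnit_det_thetaIdx {n : ℕ} (hn : n ≠ 0) {τ : ℂ} (hτ : 0 < τ.im) (x : Fin n → ℂ)
    (hsum : theta τ (∑ k, x k) ≠ 0) (hne : ∀ i j, i ≠ j → theta τ (x i - x j) ≠ 0) :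
    IsUnit (Matrix.of fun j k : Fin n => thetaIdx n τ (j + 1) (x k)).det := by
  classical
  -- The product vanishes at every `x_j` with `j ≠ k`. Its remaining zero is chosen so that all
  -- zeros sum to zero, as the multiplier of the `θ_j` demands; at `x_k` that factor is `θ(∑ x_l)`.
  have hex : ∀ k : Fin n, ∃ c : Fin n → ℂ, ∀ z,
      ∏ j, theta τ (z - (if j = k then x k - ∑ l, x l else x j)) =
        ∑ j : Fin n, c j * thetaIdx n τ (j + 1) z := by
    intro k
    set b : Fin n → ℂ := fun j => if j = k then x k - ∑ l, x l else x j with hb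
    have hbs : ∑ j, b j = 0 := by
      have : ∀ j, b j = x j - if j = k then ∑ l, x l else 0 := by
        intro j; by_cases h : j = k <;> simp [hb, h]
      simp [this]
    have hT := IsThetaSeries.prod Finset.univ fun j _ => isThetaSeries_theta hτ (b j)
    rw [← Complex.exp_sum, ← Finset.mul_sum, Finset.sum_sub_distrib, hbs] at hT
    simp only [Finset.sum_const, Finset.card_univ, Fintype.card_fin, nsmul_eq_mul, mul_one,
      sub_zero] at hT
    rw [show (n : ℂ) * (1 / 2 + τ) = n / 2 + n * τ by ring] at hT
    obtain ⟨c, hc⟩ := hT.exists_eq_sum_thetaIdx hn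
    refine ⟨c, fun z => ?_⟩
    rw [← hc z, Finset.prod_apply, Finset.prod_mul_distrib, ← Complex.exp_sum, ← mul_assoc,
      ← Complex.exp_add]
    simp [mul_left_comm, hb]
  choose c hc using hex
  have hprod : Matrix.of c * Matrix.of (fun j k : Fin n => thetaIdx n τ (j + 1) (x k)) =
      Matrix.diagonal fun k =>
        ∏ j, theta τ (x k - (if j = k then x k - ∑ l, x l else x j)) := by
    ext k m
    rw [Matrix.mul_apply]
    simp only [Matrix.of_apply]
    rw [← hc k (x m)]
    rcases eq_or_ne k m with rfl | hkm
    · rw [Matrix.diagonal_apply_eq]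
    · rw [Matrix.diagonal_apply_ne _ hkm]
      refine Finset.prod_eq_zero (Finset.mem_univ m) ?_
      rw [if_neg hkm.symm, sub_self, theta_zero]
  rw [isUnit_iff_ne_zero]
  intro h0
  have := congrArg Matrix.det hprod
  rw [Matrix.det_mul, h0, mul_zero, Matrix.det_diagonal] at this
  refine Finset.prod_ne_zero_iff.mpr (fun k _ => ?_) this.symm
  refine Finset.prod_ne_zero_iff.mpr fun j _ => ?_
  by_cases h : j = k
  · simpa [h] using hsum
  · simpa [h] using hne k j (Ne.symm h)

/-! ### Linear algebra -/

/-- The expansion of the characteristic determinant in principal minors. -/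
theorem det_sub_smul_one {R : Type*} [CommRing R] {n : ℕ} (A : Matrix (Fin n) (Fin n) R) (t : R) :
    (A - t • 1).det = ∑ d ∈ Finset.range (n + 1),
      (-t) ^ (n - d) * ∑ i : Fin d ↪o Fin n, (A.submatrix i i).det := by
  nontriviality R
  have hminor : ∀ d, ∑ s ∈ (Finset.univ : Finset (Fin n)).powersetCard d,
      (A.submatrix (Subtype.val : s → Fin n) Subtype.val).det =
        ∑ i : Fin d ↪o Fin n, (A.submatrix i i).det := by
    intro d
    symm
    refine Finset.sum_bij' (fun i _ => Finset.univ.map i.toEmbedding)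
      (fun s hs => s.orderEmbOfFin (Finset.mem_powersetCard.mp hs).2) ?_ ?_ ?_ ?_ ?_
    · intro i _; simp [Finset.mem_powersetCard]
    · intro s _; simp
    · intro i _
      symm
      apply Finset.orderEmbOfFin_unique'
      simp
    · intro s hs
      ext x; simp
    · intro i _
      let e : Fin d ≃ ↥(Finset.univ.map i.toEmbedding) :=
        Equiv.ofBijective (fun a => ⟨i a, by simp⟩)
          ⟨fun a b h => i.injective (congrArg Subtype.val h), fun ⟨x, hx⟩ => by
            obtain ⟨a, _, rfl⟩ := Finset.mem_map.mp hx; exact ⟨a, rfl⟩⟩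
      rw [← Matrix.det_submatrix_equiv_self e]
      rfl
  have h1 : (A - t • 1).det = (-1) ^ n * A.charpoly.eval t := by
    rw [Matrix.eval_charpoly, ← neg_sub, Matrix.det_neg, Fintype.card_fin, Matrix.smul_one_eq_diagonal]
    rfl
  rw [h1, Polynomial.eval_eq_sum_range, A.charpoly_natDegree_eq_dim, Fintype.card_fin,
    ← Finset.sum_range_reflect, Finset.mul_sum]
  refine Finset.sum_congr rfl fun d hd => ?_
  have hd' : d ≤ n := Nat.lt_succ_iff.mp (Finset.mem_range.mp hd)
  have h2 := A.charpoly_coeff_eq_sum_minors d (by simpa using hd')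
  rw [Fintype.card_fin, hminor] at h2
  rw [Nat.add_sub_cancel, h2, neg_pow]
  obtain ⟨m, rfl⟩ := Nat.exists_eq_add_of_le hd'
  rw [Nat.add_sub_cancel_left, pow_add]
  have : ((-1 : R) ^ d) * (-1) ^ d = 1 := by rw [← mul_pow]; simp
  linear_combination ((-1) ^ m * t ^ m * ∑ i : Fin d ↪o Fin (d + m), (A.submatrix i i).det) * this

/-- Let `Ψ_a` be obtained from `Φ` by changing only columns with an index `k_b`, `b < a`. Then the
rows `k_a` of the matrices `Ψ_a⁻¹` have the same exterior product as the rows `k_a` of `Φ⁻¹`. -/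
theorem det_rows_inv_eq {n d : ℕ} (Φ : Matrix (Fin n) (Fin n) ℂ) (hΦ : IsUnit Φ.det)
    (Ψ : Fin d → Matrix (Fin n) (Fin n) ℂ) (k : Fin d → Fin n)
    (hcol : ∀ a i j, (∀ b < a, k b ≠ j) → Ψ a i j = Φ i j)
    (hΨ : Function.Injective k → ∀ a, IsUnit (Ψ a).det) (i : Fin d → Fin n) :
    (Matrix.of fun a b => (Ψ a)⁻¹ (k a) (i b)).det =
      (Matrix.of fun a b => Φ⁻¹ (k a) (i b)).det := by
  classical
  -- Row `a` of `P` holds the coordinates of row `k_a` of `Ψ_a⁻¹` in the basis of rows of `Φ⁻¹`.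
  set P : Matrix (Fin d) (Fin n) ℂ := (Matrix.of fun a => (Ψ a)⁻¹ (k a)) * Φ with hP
  have hunit : ∀ a j, IsUnit (Ψ a).det → (∀ b < a, k b ≠ j) →
      P a j = (1 : Matrix (Fin n) (Fin n) ℂ) (k a) j := by
    intro a j ha hj
    rw [← Matrix.nonsing_inv_mul _ ha, hP, Matrix.mul_apply, Matrix.mul_apply]
    exact Finset.sum_congr rfl fun l _ => by rw [hcol a l j hj]; rfl
  have hzero : ∀ a j, j ∉ Finset.univ.image k → P a j = 0 := by
    intro a j hj
    have hj' : ∀ b, k b ≠ j := fun b hb => hj (Finset.mem_image.mpr ⟨b, Finset.mem_univ b, hb⟩)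
    by_cases ha : IsUnit (Ψ a).det
    · rw [hunit a j ha fun b _ => hj' b, Matrix.one_apply_ne (hj' a)]
    -- A singular `Ψ_a` has inverse `0` by convention, so the support claim needs no invertibility.
    · rw [hP, Matrix.mul_apply]
      simp [Matrix.nonsing_inv_apply_not_isUnit _ ha]
  -- Dividing by the multiplicity of `k c` compensates for repeated directions, so the factorization
  -- through `U` holds for every `k`.
  set U : Matrix (Fin d) (Fin d) ℂ :=
    Matrix.of fun a c => P a (k c) / (Finset.univ.filter fun c' => k c' = k c).card with hU
  have hfac : (Matrix.of fun a b => (Ψ a)⁻¹ (k a) (i b)) =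
      U * Matrix.of fun a b => Φ⁻¹ (k a) (i b) := by
    ext a b
    have h1 : (Ψ a)⁻¹ (k a) (i b) = ∑ j, P a j * Φ⁻¹ j (i b) := by
      rw [← Matrix.mul_apply, hP, Matrix.mul_assoc, Matrix.mul_nonsing_inv _ hΦ, Matrix.mul_one]
      rfl
    rw [Matrix.of_apply, h1, Matrix.mul_apply]
    simp only [hU, Matrix.of_apply]
    rw [Finset.sum_comp (fun j => P a j / (Finset.univ.filter fun c' => k c' = j).card *
      Φ⁻¹ j (i b)) k]
    rw [← Finset.sum_subset (Finset.subset_univ (Finset.univ.image k))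
      fun j _ hj => by rw [hzero a j hj, zero_mul]]
    refine Finset.sum_congr rfl fun j hj => ?_
    obtain ⟨c, _, rfl⟩ := Finset.mem_image.mp hj
    have : ((Finset.univ.filter fun c' => k c' = k c).card : ℂ) ≠ 0 :=
      Nat.cast_ne_zero.mpr (Finset.card_ne_zero_of_mem (a := c) (by simp))
    rw [nsmul_eq_mul]
    field_simp
  rw [hfac, Matrix.det_mul]
  by_cases hk : Function.Injective k
  · have hUP : ∀ a c, U a c = P a (k c) := by
      intro a c
      simp [hU, hk.eq_iff, Finset.filter_eq']
    have hlow : ∀ a c, a ≤ c → U a c = (1 : Matrix (Fin d) (Fin d) ℂ) a c := by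
      intro a c hac
      rw [hUP, hunit a _ (hΨ hk a) fun b hb h => (hb.trans_le hac).ne (hk h)]
      simp [Matrix.one_apply, hk.eq_iff]
    rw [Matrix.det_of_isLowerTriangular]
    · simp [hlow _ _ le_rfl]
    · intro a c hac
      have hac' : a < c := hac
      rw [hlow a c hac'.le, Matrix.one_apply_ne hac'.ne]
  · obtain ⟨a, b, hab, hne⟩ : ∃ a b, k a = k b ∧ a ≠ b := by
      simpa [Function.Injective] using hk
    have h0 : (Matrix.of fun a b => Φ⁻¹ (k a) (i b)).det = 0 :=
      Matrix.det_zero_of_row_eq hne (by ext c; simp [hab])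
    rw [h0, mul_zero]

/-! ### Products of first order difference operators -/

/-- The product of first order difference operators, expanded over the shifts. -/
theorem prod_ofFn_apply {n N d : ℕ} (s : Fin N → weightSpace n) (C : Fin d → Fin N → Fn n)
    (f : Fn n) (v : weightSpace n) :
    (List.ofFn fun a => ∑ k, mulOp (C a k) * shiftOp (s k)).prod f v =
      ∑ k : Fin d → Fin N, (∏ a, C a (k a) (v + ∑ b, if b < a then s (k b) else 0)) *
        f (v + ∑ a, s (k a)) := by
  induction d generalizing v with
  | zero => simp
  | succ d ih =>
    rw [List.ofFn_succ, List.prod_cons, Module.End.mul_apply]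
    simp only [LinearMap.sum_apply, Finset.sum_apply, Module.End.mul_apply]
    rw [← (Fin.consEquiv fun _ => Fin N).sum_comp, Fintype.sum_prod_type]
    refine Finset.sum_congr rfl fun k₀ _ => ?_
    change C 0 k₀ v * (List.ofFn fun a : Fin d =>
      ∑ k, mulOp (C a.succ k) * shiftOp (s k)).prod f (v + s k₀) = _
    rw [ih (fun a => C a.succ), Finset.mul_sum]
    refine Finset.sum_congr rfl fun k _ => ?_
    simp only [Fin.consEquiv_apply, Fin.prod_univ_succ, Fin.sum_univ_succ, Fin.cons_zero,
      Fin.cons_succ, Fin.succ_lt_succ_iff, Fin.succ_pos, if_true, Fin.not_lt_zero, if_false,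
      Finset.sum_const_zero, add_zero, add_assoc, mul_assoc]

/-! ### Symbols and their evaluation at a point -/

/-- `quantize` as an additive homomorphism. -/
noncomputable def quantizeHom (n : ℕ) : DiffSymbol n →+ Op n where
  toFun := quantize
  map_zero' := by simp [quantize]
  map_add' := quantize_add

theorem quantizeHom_apply {n : ℕ} (s : DiffSymbol n) : quantizeHom n s = quantize s := rfl

/-- A function on the left is already in normal order, so here composition and normal product agree.
-/
theorem mulOp_mul_quantize {n : ℕ} (g : Fn n) (s : DiffSymbol n) :
    mulOp g * quantize s = quantize (AddMonoidAlgebra.single 0 g * s) := by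
  induction s using AddMonoidAlgebra.induction_linear with
  | zero => rw [mul_zero, ← quantizeHom_apply, map_zero, mul_zero]
  | add s s' h h' => rw [quantize_add, mul_add, mul_add, quantize_add, h, h']
  | single w a =>
    rw [AddMonoidAlgebra.single_mul_single, zero_add, quantize_single, quantize_single]
    ext f v
    simp [mulOp, mul_assoc]

/-- The value at `v` of a difference operator applied to `f`, as a functional of the symbol with
coefficients evaluated at `v`. -/
noncomputable def symbolEval {n : ℕ} (f : Fn n) (v : weightSpace n) :
    AddMonoidAlgebra ℂ (weightSpace n) →ₗ[ℂ] ℂ :=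
  Finsupp.linearCombination ℂ (fun w => f (v + w)) ∘ₗ
    (AddMonoidAlgebra.coeffLinearEquiv ℂ).toLinearMap

theorem symbolEval_single {n : ℕ} (f : Fn n) (v w : weightSpace n) (a : ℂ) :
    symbolEval f v (AddMonoidAlgebra.single w a) = a * f (v + w) := by
  simp [symbolEval]

theorem single_zero_eq_algebraMap {n : ℕ} (a : ℂ) :
    (AddMonoidAlgebra.single 0 a : AddMonoidAlgebra ℂ (weightSpace n)) = algebraMap ℂ _ a := by
  simp

/-- Evaluation of the coefficients of a symbol at `v`. -/
noncomputable def coeffEval {n : ℕ} (v : weightSpace n) :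
    DiffSymbol n →+* AddMonoidAlgebra ℂ (weightSpace n) :=
  AddMonoidAlgebra.mapRingHom _ (Pi.evalRingHom (fun _ => ℂ) v)

theorem coeffEval_single {n : ℕ} (v w : weightSpace n) (a : Fn n) :
    coeffEval v (AddMonoidAlgebra.single w a) = AddMonoidAlgebra.single w (a v) := by
  simp [coeffEval]

/-- The normal product never shifts coefficients, so normally ordered determinants can be computed
with coefficients frozen at one point. -/
theorem quantize_apply_eq {n : ℕ} (s : DiffSymbol n) (f : Fn n) (v : weightSpace n) :
    quantize s f v = symbolEval f v (coeffEval v s) := by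
  induction s using AddMonoidAlgebra.induction_linear with
  | zero => simp [← quantizeHom_apply]
  | add s s' h h' =>
    rw [quantize_add, map_add, map_add, LinearMap.add_apply, Pi.add_apply, h, h']
  | single w a =>
    rw [quantize_single, coeffEval_single, symbolEval_single]
    rfl

theorem normalDet_apply {n : ℕ} (A : Matrix (Fin n) (Fin n) (DiffSymbol n)) (f : Fn n)
    (v : weightSpace n) :
    normalDet (A.map quantize) f v = symbolEval f v (A.map (coeffEval v)).det := by
  rw [normalDet, Matrix.map_map, quantize_apply_eq, RingHom.map_det]
  have h : A.map (symbol ∘ quantize) = A := by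
    ext1 i j
    exact symbol_quantize (A i j)
  rw [h]
  rfl

/-! ### The weight space -/

theorem pairing_epsBar {n : ℕ} (v : weightSpace n) (k : Fin n) :
    pairing v (epsBar n k) = v.1 k := by
  have hv : ∑ i, v.1 i = 0 := v.2
  simp [pairing, epsBar, mul_sub, Finset.sum_sub_distrib, ← Finset.sum_mul, hv]

theorem pairing_epsBar_sub {n : ℕ} (v : weightSpace n) (i j : Fin n) :
    pairing v (epsBar n i - epsBar n j) = v.1 i - v.1 j := by
  rw [← pairing_epsBar, ← pairing_epsBar]
  simp [pairing, mul_sub, Finset.sum_sub_distrib]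

/-- The number of `b < a` with `k b = j`. -/
def visits {n d : ℕ} (k : Fin d → Fin n) (a : Fin d) (j : Fin n) : ℕ :=
  (Finset.univ.filter fun b => b < a ∧ k b = j).card

/-- Each `ε̄` lowers every coordinate by `1/n`; the resulting `aħ/n` is what cancels the change `u ↦
u - aħ` in `u/n`. -/
theorem shifted_apply {n d : ℕ} (ℏ : ℂ) (v : weightSpace n) (k : Fin d → Fin n) (a : Fin d)
    (j : Fin n) :
    (v + ∑ b, if b < a then ℏ • epsBar n (k b) else 0 : weightSpace n).1 j =
      v.1 j + ℏ * visits k a j - a * ℏ / n := by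
  have h : ∀ b, (if b < a then ℏ • epsBar n (k b) else 0 : weightSpace n).1 j =
      ℏ * (if b < a ∧ k b = j then 1 else 0) - if b < a then ℏ / n else 0 := by
    intro b
    by_cases hb : b < a
    · simp only [hb, if_true, true_and, epsBar, Submodule.coe_smul, Pi.smul_apply, smul_eq_mul,
        eq_comm (a := j)]
      ring
    · simp [hb]
  have hcard : (Finset.univ.filter fun b : Fin d => b < a).card = (a : ℕ) := by
    rw [← Fin.card_Iio a]; congr 1; ext; simp
  rw [Submodule.coe_add, Pi.add_apply, Submodule.coe_sum, Finset.sum_apply,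
    Finset.sum_congr rfl fun b _ => h b, Finset.sum_sub_distrib, ← Finset.mul_sum, Finset.sum_boole,
    ← Finset.sum_filter, Finset.sum_const, hcard, visits, nsmul_eq_mul]
  ring

/-! ### Intertwining vectors -/

/-- The coordinates of `v` sum to zero, so the arguments `w/n - v_k` sum to `w`. -/
theorem isUnit_det_outVec {n : ℕ} (hn : n ≠ 0) {τ : ℂ} (hτ : 0 < τ.im) (w : ℂ) (v : weightSpace n)
    (hw : theta τ w ≠ 0) (hv : ∀ i j, i ≠ j → theta τ (v.1 i - v.1 j) ≠ 0) :
    IsUnit (outVec n τ w v).det := by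
  have hη : (I * ModularForm.eta τ)⁻¹ ≠ 0 :=
    inv_ne_zero (mul_ne_zero I_ne_zero (ModularForm.eta_ne_zero hτ))
  have h : outVec n τ w v = (I * ModularForm.eta τ)⁻¹ •
      Matrix.of fun j k : Fin n => thetaIdx n τ (j + 1) (w / n - v.1 k) := by
    ext j k
    simp only [outVec, Matrix.of_apply, Matrix.smul_apply, pairing_epsBar, smul_eq_mul]
    ring
  have hv0 : ∑ i, v.1 i = 0 := v.2
  rw [h, Matrix.det_smul]
  refine (hη.isUnit.pow _).mul (isUnit_det_thetaIdx hn hτ _ ?_ fun i j hij => ?_)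
  · have hn' : (n : ℂ) ≠ 0 := Nat.cast_ne_zero.mpr hn
    simpa [Finset.sum_sub_distrib, hv0, mul_div_cancel₀ _ hn'] using hw
  · simpa using hv j i hij.symm

/-- After the shifts `k_b`, `b < a`, the intertwining vectors with spectral parameter lowered by
`aħ` depend only on the number of shifts in their own direction. -/
theorem outVec_shifted {n d : ℕ} (τ ℏ w : ℂ) (v : weightSpace n) (k : Fin d → Fin n)
    (a : Fin d) (i j : Fin n) :
    outVec n τ (w - (a : ℕ) * ℏ) (v + ∑ b, if b < a then ℏ • epsBar n (k b) else 0) i j =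
      thetaIdx n τ (i + 1) (w / n - v.1 j - ℏ * visits k a j) / (I * ModularForm.eta τ) := by
  rw [outVec, Matrix.of_apply, pairing_epsBar, shifted_apply]
  congr 2
  ring

theorem outVec_shifted_of_forall_ne {n d : ℕ} (τ ℏ w : ℂ) (v : weightSpace n)
    (k : Fin d → Fin n) (a : Fin d) (i j : Fin n) (hj : ∀ b < a, k b ≠ j) :
    outVec n τ (w - (a : ℕ) * ℏ) (v + ∑ b, if b < a then ℏ • epsBar n (k b) else 0) i j =
      outVec n τ w v i j := by
  have : visits k a j = 0 := by
    rw [visits, Finset.card_eq_zero, Finset.filter_eq_empty_iff]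
    exact fun b _ h => hj b h.1 h.2
  rw [outVec_shifted, this, outVec, Matrix.of_apply, pairing_epsBar]
  simp

/-- Injectivity allows at most one visit per direction, so coordinate differences move by `mħ` with
`|m| ≤ 1 < n`. -/
theorem isUnit_det_outVec_shifted {n d : ℕ} (hn : 1 < n) {τ ℏ u : ℂ} (hτ : 0 < τ.im)
    (hu : ∀ k : ℕ, k < n → theta τ (u - k * ℏ) ≠ 0) {v : weightSpace n}
    (hv : v ∈ regularSet n τ ℏ) (hd : d ≤ n) (k : Fin d → Fin n) (hk : Function.Injective k)
    (a : Fin d) :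
    IsUnit (outVec n τ (u - (a : ℕ) * ℏ)
      (v + ∑ b, if b < a then ℏ • epsBar n (k b) else 0)).det := by
  refine isUnit_det_outVec (by omega) hτ _ _ (hu a (a.2.trans_le hd)) fun i j hij => ?_
  have hle : ∀ j, visits k a j ≤ 1 := fun j => Finset.card_le_one.mpr fun b hb b' hb' => by
    simp only [Finset.mem_filter] at hb hb'
    exact hk (hb.2.2.trans hb'.2.2.symm)
  have h := hv i j hij ((visits k a i : ℤ) - visits k a j) (by
    have := hle i
    have := hle j
    rw [abs_lt]; omega)
  rw [pairing_epsBar_sub] at h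
  rw [shifted_apply, shifted_apply]
  convert h using 2
  push_cast; ring

theorem isUnit_det_outVec_of_mem {n : ℕ} (hn : 1 < n) {τ ℏ u : ℂ} (hτ : 0 < τ.im)
    (hu : theta τ u ≠ 0) {v : weightSpace n} (hv : v ∈ regularSet n τ ℏ) :
    IsUnit (outVec n τ u v).det := by
  refine isUnit_det_outVec (by omega) hτ _ _ hu fun i j hij => ?_
  have h := hv i j hij 0 (by simpa using (by omega : 0 < n))
  rw [pairing_epsBar_sub] at h
  simpa using h

/-! ### The L-operator -/

/-- The symbol of `L(c|u)` with coefficients evaluated at `v`. -/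
noncomputable def lMat (n : ℕ) (τ ℏ c u : ℂ) (v : weightSpace n) :
    Matrix (Fin n) (Fin n) (AddMonoidAlgebra ℂ (weightSpace n)) :=
  Matrix.of fun i j => ∑ k, AddMonoidAlgebra.single (ℏ • epsBar n k)
    (outVec n τ (u + c * ℏ) v j k * inVec n τ u v k i)

/-- The symbol of `L(c|u)`. -/
noncomputable def lSymbol (n : ℕ) (τ ℏ c u : ℂ) : Matrix (Fin n) (Fin n) (DiffSymbol n) :=
  Matrix.of fun i j => ∑ k, AddMonoidAlgebra.single (ℏ • epsBar n k)
    (fun μ => outVec n τ (u + c * ℏ) μ j k * inVec n τ u μ k i)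

theorem quantize_lSymbol (n : ℕ) (τ ℏ c u : ℂ) (i j : Fin n) :
    quantize (lSymbol n τ ℏ c u i j) = lOp n τ ℏ c u i j := by
  rw [← quantizeHom_apply, lSymbol, Matrix.of_apply, map_sum, lOp, Matrix.of_apply]
  exact Finset.sum_congr rfl fun k _ => quantize_single _ _

theorem coeffEval_lSymbol (n : ℕ) (τ ℏ c u : ℂ) (v : weightSpace n) (i j : Fin n) :
    coeffEval v (lSymbol n τ ℏ c u i j) = lMat n τ ℏ c u v i j := by
  simp only [lSymbol, lMat, Matrix.of_apply, map_sum, coeffEval_single]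

theorem quantize_scalar {n : ℕ} (t : ℂ) (i j : Fin n) :
    quantize ((Matrix.scalar (Fin n) (AddMonoidAlgebra.single 0 fun _ => t : DiffSymbol n)) i j) =
      (t • (1 : Matrix (Fin n) (Fin n) (Op n))) i j := by
  rcases eq_or_ne i j with rfl | hij
  · rw [Matrix.scalar_apply, Matrix.diagonal_apply_eq, quantize_single, Matrix.smul_apply,
      Matrix.one_apply_eq]
    ext f v
    simp [mulOp, shiftOp]
  · rw [Matrix.scalar_apply, Matrix.diagonal_apply_ne _ hij, Matrix.smul_apply,
      Matrix.one_apply_ne hij, ← quantizeHom_apply, map_zero, smul_zero]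

/-- The normally ordered characteristic determinant of a matrix of difference operators. -/
theorem normalDet_sub_smul_one_apply {n : ℕ} (A : Matrix (Fin n) (Fin n) (Op n))
    (S : Matrix (Fin n) (Fin n) (DiffSymbol n)) (hS : ∀ i j, quantize (S i j) = A i j) (t : ℂ)
    (f : Fn n) (v : weightSpace n) :
    normalDet (A - t • 1) f v = symbolEval f v (S.map (coeffEval v) -
      (AddMonoidAlgebra.single 0 t : AddMonoidAlgebra ℂ (weightSpace n)) • 1).det := by
  have h : A - t • 1 = (S - Matrix.scalar (Fin n) (AddMonoidAlgebra.single 0 fun _ => t :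
      DiffSymbol n)).map quantize := by
    ext1 i j
    rw [Matrix.map_apply, Matrix.sub_apply, Matrix.sub_apply, ← quantizeHom_apply, map_sub,
      quantizeHom_apply, quantizeHom_apply, hS, quantize_scalar]
  rw [h, normalDet_apply]
  congr 2
  ext1 i j
  rw [Matrix.map_apply, Matrix.sub_apply, map_sub, Matrix.sub_apply, Matrix.map_apply]
  congr 1
  rcases eq_or_ne i j with rfl | hij
  · simp [coeffEval_single]
  · simp [hij]

/-- The symbol of `L̃(c|u)` is conjugate to that of `L(c|u)`. -/
theorem normalDet_lTildeOp {n : ℕ} (τ ℏ c u t : ℂ) (f : Fn n) (v : weightSpace n)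
    (hv : IsUnit (outVec n τ u v).det) :
    normalDet (lTildeOp n τ ℏ c u - t • 1) f v = normalDet (lOp n τ ℏ c u - t • 1) f v := by
  let S : Matrix (Fin n) (Fin n) (DiffSymbol n) := Matrix.of fun i' j' => ∑ i, ∑ j,
    AddMonoidAlgebra.single 0 (fun v => inVec n τ u v j' j * outVec n τ u v i i') *
      lSymbol n τ ℏ c u i j
  have hS : ∀ i j, quantize (S i j) = lTildeOp n τ ℏ c u i j := by
    intro i' j'
    simp only [S, lTildeOp, Matrix.of_apply, ← quantizeHom_apply, map_sum]
    simp only [quantizeHom_apply, ← mulOp_mul_quantize, quantize_lSymbol]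
  rw [normalDet_sub_smul_one_apply _ S hS,
    normalDet_sub_smul_one_apply _ _ (quantize_lSymbol n τ ℏ c u)]
  congr 1
  let ι : ℂ →+* AddMonoidAlgebra ℂ (weightSpace n) := algebraMap _ _
  -- In `L̃` both intertwining factors stand to the left of `L`, but commutativity of the normal
  -- product lets `Y` be moved to the right. The transposes match the index order.
  set X := (outVec n τ u v).transpose.map ι with hX
  set Y := (inVec n τ u v).transpose.map ι with hY
  have hXY : X * Y = 1 := by
    rw [hX, hY, ← Matrix.map_mul, ← Matrix.transpose_mul, inVec, Matrix.nonsing_inv_mul _ hv]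
    simp
  have hconj : S.map (coeffEval v) = X * (lSymbol n τ ℏ c u).map (coeffEval v) * Y := by
    ext1 i' j'
    simp only [Matrix.mul_apply, Matrix.map_apply, S, Matrix.of_apply, map_sum, map_mul,
      coeffEval_single, hX, hY, Matrix.transpose_apply, Finset.sum_mul]
    rw [Finset.sum_comm]
    refine Finset.sum_congr rfl fun j _ => Finset.sum_congr rfl fun i _ => ?_
    rw [single_zero_eq_algebraMap, map_mul]
    ring
  set s := (AddMonoidAlgebra.single 0 t : AddMonoidAlgebra ℂ (weightSpace n))
  have : X * (lSymbol n τ ℏ c u).map (coeffEval v) * Y - s • 1 =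
      X * ((lSymbol n τ ℏ c u).map (coeffEval v) - s • 1) * Y := by
    rw [Matrix.mul_sub, Matrix.sub_mul, Matrix.mul_smul, Matrix.smul_mul, Matrix.mul_one, hXY]
  rw [hconj, this, Matrix.det_mul_right_comm, hXY, Matrix.one_mul]

theorem det_eq_sum_sign_mul_prod {R : Type*} [CommRing R] {d : ℕ} (A : Matrix (Fin d) (Fin d) R) :
    A.det = ∑ σ : Equiv.Perm (Fin d), (Equiv.Perm.sign σ : ℤ) * ∏ a, A a (σ a) := by
  rw [← Matrix.det_transpose, Matrix.det_apply']
  rfl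

/-- The principal minors of the symbol of `L(c|u)`. -/
theorem symbolEval_det_submatrix_lMat {n d : ℕ} (τ ℏ c u : ℂ) (f : Fn n) (v : weightSpace n)
    (i : Fin d → Fin n) :
    symbolEval f v ((lMat n τ ℏ c u v).submatrix i i).det =
      ∑ k : Fin d → Fin n, (∏ a, outVec n τ (u + c * ℏ) v (i a) (k a)) *
        (Matrix.of fun a b => inVec n τ u v (k a) (i b)).det *
          f (v + ∑ a, ℏ • epsBar n (k a)) := by
  have h : ∀ σ : Equiv.Perm (Fin d),
      symbolEval f v (∏ a, lMat n τ ℏ c u v (i (σ a)) (i a)) =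
        ∑ k : Fin d → Fin n, (∏ a, outVec n τ (u + c * ℏ) v (i a) (k a)) *
          (∏ a, inVec n τ u v (k a) (i (σ a))) * f (v + ∑ a, ℏ • epsBar n (k a)) := by
    intro σ
    simp only [lMat, Matrix.of_apply]
    rw [Finset.prod_univ_sum, Fintype.piFinset_univ, map_sum]
    refine Finset.sum_congr rfl fun k _ => ?_
    rw [AddMonoidAlgebra.prod_single, symbolEval_single, Finset.prod_mul_distrib]
  rw [Matrix.det_apply, map_sum]
  simp only [Units.smul_def, map_zsmul, Matrix.submatrix_apply, h]
  simp only [det_eq_sum_sign_mul_prod, Matrix.of_apply, Finset.smul_sum, Finset.mul_sum,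
    Finset.sum_mul]
  rw [Finset.sum_comm]
  refine Finset.sum_congr rfl fun k _ => Finset.sum_congr rfl fun σ _ => ?_
  rw [zsmul_eq_mul]
  ring

/-- The permutation moves only upper indices, which belong to the incoming vectors. The outgoing
product thus factors out and the signed sum is a determinant. -/
theorem transferM_apply {n : ℕ} (τ ℏ c u : ℂ) (d : ℕ) (f : Fn n) (v : weightSpace n) :
    transferM n τ ℏ c u d f v = ∑ i : Fin d ↪o Fin n, ∑ k : Fin d → Fin n,
      (∏ a : Fin d, outVec n τ (u - (a : ℕ) * ℏ + c * ℏ)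
        (v + ∑ b, if b < a then ℏ • epsBar n (k b) else 0) (i a) (k a)) *
      (Matrix.of fun a b : Fin d => inVec n τ (u - (a : ℕ) * ℏ)
        (v + ∑ b, if b < a then ℏ • epsBar n (k b) else 0) (k a) (i b)).det *
      f (v + ∑ a, ℏ • epsBar n (k a)) := by
  simp only [transferM, Matrix.trace, Matrix.diag_apply, fusedL, Matrix.of_apply,
    LinearMap.sum_apply, Finset.sum_apply, LinearMap.smul_apply, Pi.smul_apply, lOp,
    prod_ofFn_apply]
  refine Finset.sum_congr rfl fun i _ => ?_
  simp only [det_eq_sum_sign_mul_prod, Matrix.of_apply, Finset.smul_sum, Finset.mul_sum,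
    Finset.sum_mul]
  rw [Finset.sum_comm]
  refine Finset.sum_congr rfl fun k _ => Finset.sum_congr rfl fun σ _ => ?_
  rw [zsmul_eq_mul, Finset.prod_mul_distrib]
  ring

/-- The transfer matrices are the normally ordered sums of principal minors of `L(c|u)`. -/
theorem transferM_apply_eq {n : ℕ} (hn : 1 < n) {τ ℏ : ℂ} (hτ : 0 < τ.im) (c : ℂ) {u : ℂ}
    (hu : ∀ k : ℕ, k < n → theta τ (u - k * ℏ) ≠ 0) {d : ℕ} (hd : d ≤ n) (f : Fn n)
    {v : weightSpace n} (hv : v ∈ regularSet n τ ℏ) :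
    transferM n τ ℏ c u d f v =
      symbolEval f v (∑ i : Fin d ↪o Fin n, ((lMat n τ ℏ c u v).submatrix i i).det) := by
  rw [transferM_apply, map_sum]
  refine Finset.sum_congr rfl fun i _ => ?_
  rw [symbolEval_det_submatrix_lMat]
  refine Finset.sum_congr rfl fun k _ => ?_
  congr 1
  have hdet := det_rows_inv_eq (outVec n τ u v)
    (isUnit_det_outVec_of_mem hn hτ (by simpa using hu 0 (by omega)) hv)
    (fun a => outVec n τ (u - (a : ℕ) * ℏ) (v + ∑ b, if b < a then ℏ • epsBar n (k b) else 0)) k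
    (fun a => outVec_shifted_of_forall_ne τ ℏ u v k a)
    (fun hk => isUnit_det_outVec_shifted hn hτ hu hv hd k hk) i
  simp only [inVec]
  rw [hdet]
  -- The outgoing factors agree only if no direction recurs; otherwise the incoming minor has two
  -- equal rows and annihilates them.
  by_cases hk : Function.Injective k
  · congr 1
    refine Finset.prod_congr rfl fun a _ => ?_
    rw [show u - (a : ℕ) * ℏ + c * ℏ = u + c * ℏ - (a : ℕ) * ℏ by ring]
    exact outVec_shifted_of_forall_ne τ ℏ _ v k a _ _ fun b hb h => hb.ne (hk h)
  · obtain ⟨a, b, hab, hne⟩ : ∃ a b, k a = k b ∧ a ≠ b := by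
      simpa [Function.Injective] using hk
    have h0 : (Matrix.of fun a b => (outVec n τ u v)⁻¹ (k a) (i b)).det = 0 :=
      Matrix.det_zero_of_row_eq hne (by ext c; simp [hab])
    rw [h0, mul_zero, mul_zero]

/-- The generating function of the transfer matrices is the normally ordered characteristic
determinant of `L(c|u)`. -/
theorem sum_transferM_apply {n : ℕ} (hn : 1 < n) {τ ℏ : ℂ} (hτ : 0 < τ.im) (c : ℂ) {u : ℂ}
    (hu : ∀ k : ℕ, k < n → theta τ (u - k * ℏ) ≠ 0) (t : ℂ) (f : Fn n)
    {v : weightSpace n} (hv : v ∈ regularSet n τ ℏ) :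
    (∑ d ∈ Finset.range (n + 1), (-t) ^ (n - d) • transferM n τ ℏ c u d) f v =
      normalDet (lOp n τ ℏ c u - t • 1) f v := by
  have hS : (lSymbol n τ ℏ c u).map (coeffEval v) = lMat n τ ℏ c u v := by
    ext1 i j
    exact coeffEval_lSymbol n τ ℏ c u v i j
  rw [normalDet_sub_smul_one_apply _ _ (quantize_lSymbol n τ ℏ c u), hS, det_sub_smul_one, map_sum,
    LinearMap.sum_apply, Finset.sum_apply]
  refine Finset.sum_congr rfl fun d hd => ?_
  rw [LinearMap.smul_apply, Pi.smul_apply,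
    transferM_apply_eq hn hτ c hu (Nat.lt_succ_iff.mp (Finset.mem_range.mp hd)) f hv,
    ← map_smul]
  congr 1
  rw [single_zero_eq_algebraMap, ← map_neg, ← map_pow, Algebra.smul_def]

end EllipticRuijsenaars

open EllipticRuijsenaars in
theorem theorem3 (n : ℕ) (hn : 1 < n) (τ ℏ : ℂ) (hτ : 0 < τ.im)
    (hℏ : ∀ a b : ℤ, ℏ ≠ a + b * τ) (c u : ℂ)
    (hu : ∀ k : ℕ, k < n → theta τ (u - k * ℏ) ≠ 0) (t : ℂ)
    (f : weightSpace n → ℂ) (v : weightSpace n) (hv : v ∈ regularSet n τ ℏ) :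
    (∑ d ∈ Finset.range (n + 1), (-t) ^ (n - d) • transferM n τ ℏ c u d) f v =
      normalDet (lOp n τ ℏ c u - t • 1) f v ∧
    (∑ d ∈ Finset.range (n + 1), (-t) ^ (n - d) • transferM n τ ℏ c u d) f v =
      normalDet (lTildeOp n τ ℏ c u - t • 1) f v := by
  have h := sum_transferM_apply hn hτ c hu t f hv
  refine ⟨h, h.trans (normalDet_lTildeOp τ ℏ c u t f v ?_).symm⟩
  exact isUnit_det_outVec_of_mem hn hτ (by simpa using hu 0 (by omega)) hv
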